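/- Let $\mathfrak{A}$ be a (not necessarily unital) $C^*$-algebra, let $H$ be a Hilbert $\mathfrak{A}$-module, and let $\mathcal{L}(H)$ be the $C^*$-algebra of adjointable operators on $H$, with unit $I$ and the operator norm. An element $T\in\mathcal{L}(H)$ is called M-P invertible if there is $X\in\mathcal{L}(H)$ with $$TXT=T,\qquad XTX=X,\qquad (TX)^*=TX,\qquad (XT)^*=XT;$$ such an $X$ is unique, is called the Moore-Penrose inverse of $T$, and is denoted by $T^\dagger$. **Theorem.** Let $A,B\in\mathcal{L}(H)$ be positive elements such that $A$ and $A+B$ are both M-P invertible. Then $(I-A^\dagger A)B(I-A^\dagger A)$ is M-P invertible, $\lambda A+B$ is M-P invertible for every real $\lambda>0$, and $$\lim_{\lambda\to+\infty}(\lambda A+B)^\dagger B=\big[(I-A^\dagger A)B(I-A^\dagger A)\big]^\dagger B$$ in the operator norm. -/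

import Mathlib

open Filter Topology

noncomputable section

section HilbertModule

variable (𝔄 : Type*) {H : Type*} [NonUnitalCStarAlgebra 𝔄] [PartialOrder 𝔄]
  [NormedAddCommGroup H] [NormedSpace ℂ H] [SMul 𝔄 H] [CStarModule 𝔄 H]

/-- `S` is an adjoint of `T` for the `𝔄`-valued inner product of `H`. -/
def IsAdjointOf (T S : H →L[ℂ] H) : Prop :=
  ∀ x y : H, inner 𝔄 (T x) y = inner 𝔄 x (S y)

variable {𝔄}

theorem CStarModule.ext_inner_left {x y : H} (h : ∀ z : H, inner 𝔄 z x = inner 𝔄 z y) :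
    x = y := by
  have h1 : inner 𝔄 (x - y) (x - y) = 0 := by
    rw [CStarModule.inner_sub_right, h, sub_self]
  exact sub_eq_zero.mp (CStarModule.inner_self.mp h1)

namespace IsAdjointOf

variable {T T' S S' : H →L[ℂ] H}

theorem unique (h : IsAdjointOf 𝔄 T S) (h' : IsAdjointOf 𝔄 T S') : S = S' := by
  ext y
  exact CStarModule.ext_inner_left (𝔄 := 𝔄) fun x => by rw [← h x y, ← h' x y]

theorem symm (h : IsAdjointOf 𝔄 T S) : IsAdjointOf 𝔄 S T := fun x y => by
  rw [← CStarModule.star_inner y (S x), ← h y x, CStarModule.star_inner]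

theorem add (h : IsAdjointOf 𝔄 T S) (h' : IsAdjointOf 𝔄 T' S') :
    IsAdjointOf 𝔄 (T + T') (S + S') := fun x y => by
  simp [h x y, h' x y]

theorem mul (h : IsAdjointOf 𝔄 T S) (h' : IsAdjointOf 𝔄 T' S') :
    IsAdjointOf 𝔄 (T * T') (S' * S) := fun x y => by
  simp [h _ _, h' _ _]

theorem smul (h : IsAdjointOf 𝔄 T S) (c : ℂ) : IsAdjointOf 𝔄 (c • T) (star c • S) :=
  fun x y => by
    simp only [smul_apply, CStarModule.inner_smul_left_complex,
      CStarModule.inner_smul_right_complex, h x y]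

theorem one : IsAdjointOf 𝔄 (1 : H →L[ℂ] H) 1 := fun _ _ => rfl

variable [StarOrderedRing 𝔄]

/-- The inequality behind the C⋆-identity. -/
theorem norm_mul_self_le (h : IsAdjointOf 𝔄 T S) : ‖T‖ * ‖T‖ ≤ ‖S * T‖ := by
  have key : ∀ x : H, ‖T x‖ ≤ √‖S * T‖ * ‖x‖ := fun x => by
    have h1 : ‖T x‖ ^ 2 ≤ ‖S * T‖ * ‖x‖ ^ 2 := by
      rw [CStarModule.norm_sq_eq 𝔄, h x (T x)]
      calc ‖inner 𝔄 x (S (T x))‖ ≤ ‖x‖ * ‖S (T x)‖ := CStarModule.norm_inner_le H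
        _ ≤ ‖x‖ * (‖S * T‖ * ‖x‖) := by
            gcongr
            exact (S * T).le_opNorm x
        _ = ‖S * T‖ * ‖x‖ ^ 2 := by ring
    calc ‖T x‖ = √(‖T x‖ ^ 2) := (Real.sqrt_sq (norm_nonneg _)).symm
      _ ≤ √(‖S * T‖ * ‖x‖ ^ 2) := Real.sqrt_le_sqrt h1
      _ = √‖S * T‖ * ‖x‖ := by
          rw [Real.sqrt_mul (norm_nonneg _), Real.sqrt_sq (norm_nonneg _)]
  have h2 := T.opNorm_le_bound (Real.sqrt_nonneg _) key
  calc ‖T‖ * ‖T‖ ≤ √‖S * T‖ * √‖S * T‖ := by gcongr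
    _ = ‖S * T‖ := Real.mul_self_sqrt (norm_nonneg _)

theorem norm_le (h : IsAdjointOf 𝔄 T S) : ‖T‖ ≤ ‖S‖ := by
  rcases (norm_nonneg T).eq_or_lt with h0 | h0
  · rw [← h0]
    exact norm_nonneg S
  · exact le_of_mul_le_mul_right (h.norm_mul_self_le.trans (norm_mul_le S T)) h0

end IsAdjointOf

variable (𝔄 H)

/-- The adjointable operators on `H`, as a subalgebra of the bounded operators. (An arbitrary map
that has an adjoint is automatically linear and bounded.) -/
def adjointableSubalgebra : Subalgebra ℂ (H →L[ℂ] H) where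
  carrier := {T | ∃ S : H →L[ℂ] H, IsAdjointOf 𝔄 T S}
  mul_mem' := fun ⟨_, h⟩ ⟨_, h'⟩ => ⟨_, h.mul h'⟩
  add_mem' := fun ⟨_, h⟩ ⟨_, h'⟩ => ⟨_, h.add h'⟩
  algebraMap_mem' := fun c => ⟨star c • 1, by
    rw [Algebra.algebraMap_eq_smul_one]
    exact IsAdjointOf.one.smul c⟩

/-- `𝓛(H)`: the adjointable operators on the Hilbert `𝔄`-module `H`, with composition as
multiplication and the operator norm. -/
def AdjointableOperator : Type _ := adjointableSubalgebra 𝔄 H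

namespace AdjointableOperator

instance : NormedRing (AdjointableOperator 𝔄 H) :=
  inferInstanceAs (NormedRing (adjointableSubalgebra 𝔄 H))

instance : NormedAlgebra ℂ (AdjointableOperator 𝔄 H) :=
  inferInstanceAs (NormedAlgebra ℂ (adjointableSubalgebra 𝔄 H))

variable {𝔄 H}

/-- The underlying bounded operator. -/
def toCLM (T : AdjointableOperator 𝔄 H) : H →L[ℂ] H := T.1

theorem exists_adjoint (T : AdjointableOperator 𝔄 H) :
    ∃ S : AdjointableOperator 𝔄 H, IsAdjointOf 𝔄 T.toCLM S.toCLM :=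
  let ⟨S, hS⟩ := T.2
  ⟨⟨S, ⟨T.1, hS.symm⟩⟩, hS⟩

/-- The involution is the adjoint: `⟪T x, y⟫ = ⟪x, (star T) y⟫`. -/
instance : Star (AdjointableOperator 𝔄 H) := ⟨fun T => T.exists_adjoint.choose⟩

theorem isAdjointOf_star (T : AdjointableOperator 𝔄 H) :
    IsAdjointOf 𝔄 T.toCLM (star T).toCLM := T.exists_adjoint.choose_spec

theorem star_eq_of_isAdjointOf {T S : AdjointableOperator 𝔄 H}
    (h : IsAdjointOf 𝔄 T.toCLM S.toCLM) : star T = S :=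
  Subtype.ext (T.isAdjointOf_star.unique h)

instance : StarRing (AdjointableOperator 𝔄 H) where
  star_involutive T := star_eq_of_isAdjointOf T.isAdjointOf_star.symm
  star_mul T S := star_eq_of_isAdjointOf (T.isAdjointOf_star.mul S.isAdjointOf_star)
  star_add T S := star_eq_of_isAdjointOf (T.isAdjointOf_star.add S.isAdjointOf_star)

instance : StarModule ℂ (AdjointableOperator 𝔄 H) where
  star_smul c T := star_eq_of_isAdjointOf (T.isAdjointOf_star.smul c)

variable [StarOrderedRing 𝔄]

instance : CStarRing (AdjointableOperator 𝔄 H) where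
  norm_mul_self_le T := T.isAdjointOf_star.norm_mul_self_le

variable [CompleteSpace H]

instance : CompleteSpace (AdjointableOperator 𝔄 H) := by
  have hclosed : IsClosed (adjointableSubalgebra 𝔄 H : Set (H →L[ℂ] H)) := by
    refine isClosed_of_closure_subset fun T hT => ?_
    obtain ⟨u, hu, hlim⟩ := mem_closure_iff_seq_limit.mp hT
    choose S hS using hu
    have hnorm : ∀ m n, ‖S m - S n‖ ≤ ‖u m - u n‖ := fun m n => by
      have h1 : IsAdjointOf 𝔄 (u m - u n) (S m - S n) := fun x y => by
        simp [hS m x y, hS n x y]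
      exact h1.symm.norm_le
    have hS_cauchy : CauchySeq S := by
      rw [Metric.cauchySeq_iff]
      intro ε hε
      obtain ⟨N, hN⟩ := Metric.cauchySeq_iff.mp hlim.cauchySeq ε hε
      refine ⟨N, fun m hm n hn => ?_⟩
      have h2 := hN m hm n hn
      rw [dist_eq_norm] at h2 ⊢
      exact (hnorm m n).trans_lt h2
    obtain ⟨S₀, hS₀⟩ := cauchySeq_tendsto_of_complete hS_cauchy
    refine ⟨S₀, fun x y => ?_⟩
    have hu_x : Tendsto (fun n => u n x) atTop (𝓝 (T x)) :=
      ((ContinuousLinearMap.apply ℂ H x).continuous.tendsto T).comp hlim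
    have hS_y : Tendsto (fun n => S n y) atTop (𝓝 (S₀ y)) :=
      ((ContinuousLinearMap.apply ℂ H y).continuous.tendsto S₀).comp hS₀
    have hl : Tendsto (fun n => inner 𝔄 (u n x) y) atTop (𝓝 (inner 𝔄 (T x) y)) :=
      (CStarModule.continuous_inner.tendsto (T x, y)).comp (hu_x.prodMk_nhds tendsto_const_nhds)
    have hr : Tendsto (fun n => inner 𝔄 x (S n y)) atTop (𝓝 (inner 𝔄 x (S₀ y))) :=
      (CStarModule.continuous_inner.tendsto (x, S₀ y)).comp
        (tendsto_const_nhds.prodMk_nhds hS_y)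
    exact tendsto_nhds_unique hl (hr.congr fun n => (hS n x y).symm)
  exact hclosed.completeSpace_coe

/-- `𝓛(H)` is a unital C⋆-algebra. -/
instance : CStarAlgebra (AdjointableOperator 𝔄 H) where

/-- The order of the C⋆-algebra `𝓛(H)`: `0 ≤ T` means that `T` is self-adjoint with spectrum in
`[0, ∞)`. -/
instance : PartialOrder (AdjointableOperator 𝔄 H) := CStarAlgebra.spectralOrder _

instance : StarOrderedRing (AdjointableOperator 𝔄 H) := CStarAlgebra.spectralOrderedRing _

end AdjointableOperator

end HilbertModule

section MoorePenrose

variable {R : Type*} [Semigroup R]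

/-- `x` is a Moore-Penrose inverse of `a`. -/
structure IsMoorePenroseInverse [Star R] (a x : R) : Prop where
  mul_mul_self : a * x * a = a
  self_mul_mul : x * a * x = x
  star_mul_right : star (a * x) = a * x
  star_mul_left : star (x * a) = x * a

/-- There is at most one Moore-Penrose inverse. -/
theorem IsMoorePenroseInverse.unique [StarMul R] {a x y : R}
    (hx : IsMoorePenroseInverse a x) (hy : IsMoorePenroseInverse a y) : x = y := by
  have h1 : a * x = a * y := by
    calc a * x = star (a * x) := hx.star_mul_right.symm
      _ = star ((a * y) * (a * x)) := by rw [← mul_assoc, hy.mul_mul_self]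
      _ = (a * x) * (a * y) := by rw [star_mul, hx.star_mul_right, hy.star_mul_right]
      _ = a * y := by rw [← mul_assoc, hx.mul_mul_self]
  have h2 : x * a = y * a := by
    calc x * a = star (x * a) := hx.star_mul_left.symm
      _ = star ((x * a) * (y * a)) := by rw [mul_assoc, ← mul_assoc a, hy.mul_mul_self]
      _ = (y * a) * (x * a) := by rw [star_mul, hx.star_mul_left, hy.star_mul_left]
      _ = y * a := by rw [mul_assoc, ← mul_assoc a, hx.mul_mul_self]
  calc x = x * a * x := hx.self_mul_mul.symm
    _ = y * a * y := by rw [h2, mul_assoc, h1, mul_assoc]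
    _ = y := hy.self_mul_mul

/-- `a` is M-P invertible. -/
def IsMPInvertible [Star R] (a : R) : Prop := ∃ x : R, IsMoorePenroseInverse a x

open Classical in
/-- The Moore-Penrose inverse `a†` of an M-P invertible element (the value `a` is a dummy when `a`
is not M-P invertible). -/
def mpInverse [Star R] (a : R) : R := if h : IsMPInvertible a then h.choose else a

theorem mpInverse_spec [Star R] {a : R} (h : IsMPInvertible a) :
    IsMoorePenroseInverse a (mpInverse a) := by
  rw [mpInverse, dif_pos h]
  exact h.choose_spec

end MoorePenrose

end

section MoorePenroseCStar

/-! ### Moore-Penrose inverses in star rings. -/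

namespace IsMoorePenroseInverse

variable {R : Type*} [Ring R] [StarRing R] {a x : R}

/-! Put `p = a†a`, `q = (a + b)†(a + b)` and `f = q - p`. By positivity `1 - q` kills both `a` and
`b`, so everything lives in the corner of `q`. There `T = a + b + (1 - q)` is strictly positive, and
its compression to `f` is `f b f = (1 - p) b (1 - p)`, which therefore has an inverse `z` in the
corner of `f` (`isStrictlyPositive_conjugate_add_one_sub`). For `l ≥ 1`, `l • a + b + (1 - q)`
dominates `T`, so `w = (l • a + b)†` is bounded independently of `l`
(`exists_norm_le_of_isStrictlyPositive_le`). The identity `w - z = l⁻¹ • (q - w b) a† (1 - b z)`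
then gives convergence at rate `1/l`. -/

theorem star_of_isSelfAdjoint (h : IsMoorePenroseInverse a x) (ha : IsSelfAdjoint a) :
    star x = x := by
  have ha' : star a = a := ha
  refine IsMoorePenroseInverse.unique (a := a) ⟨?_, ?_, ?_, ?_⟩ h
  · simpa [ha', mul_assoc] using congrArg star h.mul_mul_self
  · simpa [ha', mul_assoc] using congrArg star h.self_mul_mul
  · have := congrArg star h.star_mul_left
    simp only [star_star, star_mul, ha'] at this ⊢
    exact this
  · have := congrArg star h.star_mul_right
    simp only [star_star, star_mul, ha'] at this ⊢
    exact this

theorem commute_of_isSelfAdjoint (h : IsMoorePenroseInverse a x) (ha : IsSelfAdjoint a) :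
    a * x = x * a := by
  rw [← h.star_mul_right, star_mul, h.star_of_isSelfAdjoint ha, ha.star_eq]

theorem isStarProjection_mul_left (h : IsMoorePenroseInverse a x) : IsStarProjection (x * a) where
  isIdempotentElem := by
    rw [IsIdempotentElem, ← mul_assoc, h.self_mul_mul]
  isSelfAdjoint := h.star_mul_left

/-- A self-adjoint M-P invertible element becomes invertible once the projection onto its kernel
is added. -/
theorem isUnit_add_one_sub (h : IsMoorePenroseInverse a x) (ha : IsSelfAdjoint a) :
    IsUnit (a + (1 - x * a)) := by
  have hc := h.commute_of_isSelfAdjoint ha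
  have h1 : a * (x * a) = a := by rw [← mul_assoc, h.mul_mul_self]
  have h2 : x * a * a = a := by rw [← hc, h.mul_mul_self]
  have h3 : x * (x * a) = x := by rw [← hc, ← mul_assoc, h.self_mul_mul]
  have h4 : x * a * x = x := h.self_mul_mul
  have h5 := h.isStarProjection_mul_left.isIdempotentElem.eq
  -- The inverse is `x` on the range of `a` and the identity on its kernel.
  refine ⟨⟨a + (1 - x * a), x + (1 - x * a), ?_, ?_⟩, rfl⟩
  · simp only [add_mul, mul_add, sub_mul, mul_sub, one_mul, mul_one, h1, h4, h5, hc]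
    abel
  · simp only [add_mul, mul_add, sub_mul, mul_sub, one_mul, mul_one, h3, h2, h5]
    abel

end IsMoorePenroseInverse

theorem IsMoorePenroseInverse.mpInverse_eq {R : Type*} [Semigroup R] [StarMul R] {a x : R}
    (h : IsMoorePenroseInverse a x) : mpInverse a = x :=
  (mpInverse_spec ⟨x, h⟩).unique h

/-- An element of the corner cut out by a projection `q` that becomes invertible after adding
`1 - q` is invertible in that corner. -/
theorem isMoorePenroseInverse_units_inv_sub {R : Type*} [Ring R] [StarRing R] {m q : R} {u : Rˣ}
    (hq : IsStarProjection q) (hqm : q * m = m) (hmq : m * q = m) (hu : (u : R) = m + (1 - q)) :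
    IsMoorePenroseInverse m (↑u⁻¹ - (1 - q)) ∧ m * (↑u⁻¹ - (1 - q)) = q ∧
      (↑u⁻¹ - (1 - q)) * m = q := by
  have hqq := hq.isIdempotentElem.eq
  have hur : (u : R) * (1 - q) = 1 - q := by
    rw [hu]
    simp only [add_mul, mul_sub, sub_mul, mul_one, one_mul, hmq, hqq]
    abel
  have hru : (1 - q) * (u : R) = 1 - q := by
    rw [hu]
    simp only [mul_add, mul_sub, sub_mul, mul_one, one_mul, hqm, hqq]
    abel
  have hvr : (↑u⁻¹ : R) * (1 - q) = 1 - q := by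
    rw [Units.inv_mul_eq_iff_eq_mul, hur]
  have hrv : (1 - q) * (↑u⁻¹ : R) = 1 - q := by
    rw [Units.mul_inv_eq_iff_eq_mul, hru]
  have hm : m = u - (1 - q) := by rw [hu]; abel
  have h0 := hq.one_sub.isIdempotentElem.eq
  have h1 : m * (↑u⁻¹ - (1 - q)) = q := by
    rw [hm, sub_mul, mul_sub (u : R) ↑u⁻¹, mul_sub (1 - q) ↑u⁻¹, Units.mul_inv, hur, hrv, h0]
    abel
  have h2 : (↑u⁻¹ - (1 - q)) * m = q := by
    rw [hm, sub_mul, mul_sub (↑u⁻¹ : R) ↑u, mul_sub (1 - q) ↑u, Units.inv_mul, hru, hvr, h0]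
    abel
  refine ⟨⟨?_, ?_, ?_, ?_⟩, h1, h2⟩
  · rw [h1, hqm]
  · rw [h2]
    have : q = 1 - (1 - q) := by abel
    nth_rewrite 1 [this]
    rw [sub_mul, one_mul, mul_sub (1 - q), hrv, h0, sub_self, sub_zero]
  · rw [h1, hq.isSelfAdjoint.star_eq]
  · rw [h2, hq.isSelfAdjoint.star_eq]

/-! ### Positivity and corners in a C⋆-algebra. -/

variable {L : Type*} [CStarAlgebra L] [PartialOrder L] [StarOrderedRing L]

/-- With `t = √a r`, the hypothesis reads `t* t = 0`, so the C⋆-identity gives `t = 0`. -/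
theorem mul_eq_zero_of_conjugate_eq_zero {a r : L} (ha : 0 ≤ a) (h : star r * a * r = 0) :
    a * r = 0 := by
  have hs : star (CFC.sqrt a) = CFC.sqrt a := (IsSelfAdjoint.of_nonneg (CFC.sqrt_nonneg a)).star_eq
  have h1 : CFC.sqrt a * r = 0 := by
    rw [← CStarRing.star_mul_self_eq_zero_iff, star_mul, hs, mul_assoc, ← mul_assoc (CFC.sqrt a),
      CFC.sqrt_mul_sqrt_self a ha, ← mul_assoc, h]
  rw [← CFC.sqrt_mul_sqrt_self a ha, mul_assoc, h1, mul_zero]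

/-- Conjugation by `r` squeezes `r* a r` between `0` and `r* b r = 0`. -/
theorem mul_eq_zero_of_le {a b r : L} (ha : 0 ≤ a) (hab : a ≤ b) (hr : b * r = 0) : a * r = 0 := by
  refine mul_eq_zero_of_conjugate_eq_zero ha (le_antisymm ?_ (star_left_conjugate_nonneg ha r))
  refine (star_left_conjugate_le_conjugate hab r).trans_eq ?_
  rw [mul_assoc, hr, mul_zero]

/-- Positive elements of a corner that are bounded below there, uniformly, have uniformly bounded
inverses in the corner. -/
theorem exists_norm_le_of_isStrictlyPositive_le {s q : L} (hs : IsStrictlyPositive s)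
    (hq : IsStarProjection q) :
    ∃ K : ℝ, ∀ m : L, m * q = m → IsSelfAdjoint m → s ≤ m + (1 - q) →
      ∃ x, IsMoorePenroseInverse m x ∧ m * x = q ∧ x * m = q ∧ ‖x‖ ≤ K := by
  obtain ⟨v, rfl⟩ := hs.isUnit
  -- Inversion is antitone, so `‖s⁻¹‖` bounds the inverse of `m + (1 - q)`; the corner inverse
  -- differs from it by `1 - q`.
  refine ⟨‖(↑v⁻¹ : L)‖ + ‖1 - q‖, fun m hmq hm hle => ?_⟩
  obtain ⟨u, hu⟩ := (hs.of_le hle).isUnit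
  have hqm : q * m = m := by
    simpa [hq.isSelfAdjoint.star_eq, hm.star_eq] using congrArg star hmq
  obtain ⟨h1, h2, h3⟩ := isMoorePenroseInverse_units_inv_sub hq hqm hmq hu
  refine ⟨_, h1, h2, h3, (norm_sub_le _ _).trans ?_⟩
  gcongr
  rw [← hu] at hle
  exact CStarAlgebra.norm_le_norm_of_nonneg_of_le
    (CFC.inv_nonneg_of_nonneg u (hs.nonneg.trans hle))
    (CStarAlgebra.inv_le_inv hs.nonneg hle)

/-- The cap `c ≤ 1` serves compressions to a corner: it gives `c • (1 - f) ≤ 1 - f` on the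
complement. -/
theorem exists_pos_smul_one_le {s : L} (hs : IsStrictlyPositive s) :
    ∃ c : ℝ, 0 < c ∧ c ≤ 1 ∧ c • (1 : L) ≤ s := by
  rcases subsingleton_or_nontrivial L with hL | hL
  · exact ⟨1, one_pos, le_rfl, (Subsingleton.elim _ _).le⟩
  obtain ⟨c, hc, hcs⟩ : ∃ c > 0, (algebraMap ℝ L) c ≤ s :=
    (CFC.exists_pos_algebraMap_le_iff hs.isSelfAdjoint).2 fun x hx => hs.spectrum_pos hx
  refine ⟨min c 1, by positivity, min_le_right _ _, ?_⟩
  rw [Algebra.algebraMap_eq_smul_one] at hcs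
  exact (smul_le_smul_of_nonneg_right (min_le_left _ _) zero_le_one).trans hcs

/-- Compressing a strictly positive element to a corner gives a strictly positive element of that
corner. -/
theorem isStrictlyPositive_conjugate_add_one_sub {s f : L} (hs : IsStrictlyPositive s)
    (hf : IsStarProjection f) : IsStrictlyPositive (f * s * f + (1 - f)) := by
  obtain ⟨c, hc, hc1, hcs⟩ := exists_pos_smul_one_le hs
  refine (IsStrictlyPositive.smul hc isStrictlyPositive_one).of_le ?_
  have h1 : c • f ≤ f * s * f := by
    have := hf.isSelfAdjoint.conjugate_le_conjugate hcs
    simpa [hf.isIdempotentElem.eq] using this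
  have h2 : c • (1 - f) ≤ 1 - f := by
    have := smul_le_smul_of_nonneg_right hc1 hf.one_sub.nonneg
    simpa only [one_smul] using this
  calc c • (1 : L) = c • f + c • (1 - f) := by rw [← smul_add]; congr 1; abel
    _ ≤ _ := add_le_add h1 h2

/-! ### The limit theorem. -/

/-- The limit of `(l • a + b)† b` in a unital C⋆-algebra. -/
theorem tendsto_mpInverse_smul_add_mul {a b : L} (ha : 0 ≤ a) (hb : 0 ≤ b)
    (ha_mp : IsMPInvertible a) (hab_mp : IsMPInvertible (a + b)) :
    IsMPInvertible ((1 - mpInverse a * a) * b * (1 - mpInverse a * a)) ∧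
    (∀ l : ℝ, 0 < l → IsMPInvertible (l • a + b)) ∧
    Tendsto (fun l : ℝ => mpInverse (l • a + b) * b) atTop
      (𝓝 (mpInverse ((1 - mpInverse a * a) * b * (1 - mpInverse a * a)) * b)) := by
  have hx := mpInverse_spec ha_mp
  have hy := mpInverse_spec hab_mp
  set x := mpInverse a
  set y := mpInverse (a + b)
  have has := IsSelfAdjoint.of_nonneg ha
  have hbs := IsSelfAdjoint.of_nonneg hb
  have hab : 0 ≤ a + b := add_nonneg ha hb
  have hq := hy.isStarProjection_mul_left
  have hp := hx.isStarProjection_mul_left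
  have hT : IsStrictlyPositive (a + b + (1 - y * (a + b))) :=
    ⟨add_nonneg hab hq.one_sub.nonneg, hy.isUnit_add_one_sub (.of_nonneg hab)⟩
  have hSr : (a + b) * (1 - y * (a + b)) = 0 := by
    rw [mul_sub, mul_one, ← mul_assoc, hy.mul_mul_self, sub_self]
  set q := y * (a + b)
  clear_value q
  have har := mul_eq_zero_of_le ha (le_add_of_nonneg_right hb) hSr
  have hbr := mul_eq_zero_of_le hb (le_add_of_nonneg_left ha) hSr
  have haq : a * q = a := by rwa [mul_sub, mul_one, sub_eq_zero, eq_comm] at har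
  have hbq : b * q = b := by rwa [mul_sub, mul_one, sub_eq_zero, eq_comm] at hbr
  have hqb : q * b = b := by
    simpa [hq.isSelfAdjoint.star_eq, hbs.star_eq] using congrArg star hbq
  have hax : a * (x * a) = a := by rw [← mul_assoc, hx.mul_mul_self]
  have hpx : a * x = x * a := hx.commute_of_isSelfAdjoint has
  have hpq : x * a * q = x * a := by rw [mul_assoc, haq]
  set p := x * a
  clear_value p
  have hqp : q * p = p := by
    simpa [hq.isSelfAdjoint.star_eq, hp.isSelfAdjoint.star_eq] using congrArg star hpq
  have hf : IsStarProjection (q - p) := hp.sub_of_mul_eq_left hq hpq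
  have haf : a * (q - p) = 0 := by rw [mul_sub, haq, hax, sub_self]
  set f := q - p with hf_def
  -- `1 - p` and `f` differ by `1 - q`, which `b` annihilates on both sides.
  have hC : (1 - p) * b * (1 - p) = f * b * f := by
    have h1 : (1 - p) * b = f * b := by rw [hf_def, sub_mul, sub_mul, hqb, one_mul]
    have h2 : b * (1 - p) = b * f := by rw [hf_def, mul_sub, mul_sub, hbq, mul_one]
    rw [h1, mul_assoc, h2, ← mul_assoc]
  rw [hC]
  have hqf : q * f = f := by rw [hf_def, mul_sub, hqp, hq.isIdempotentElem.eq]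
  have hC' : f * (a + b + (1 - q)) * f = f * b * f := by
    simp only [mul_assoc, add_mul, sub_mul, haf, hqf, one_mul, sub_self, zero_add, add_zero]
  have hCT := isStrictlyPositive_conjugate_add_one_sub hT hf
  rw [hC'] at hCT
  obtain ⟨_, hCK⟩ := exists_norm_le_of_isStrictlyPositive_le hCT hf
  obtain ⟨z, hz, hz1, hz2, -⟩ := hCK (f * b * f) (by rw [mul_assoc, hf.isIdempotentElem.eq])
    (.of_nonneg (hf.isSelfAdjoint.conjugate_nonneg hb)) le_rfl
  have hzf : f * z = z := by
    rw [← hz2, hz.self_mul_mul]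
  have hmq (l : ℝ) : (l • a + b) * q = l • a + b := by rw [add_mul, smul_mul_assoc, haq, hbq]
  have hms (l : ℝ) : IsSelfAdjoint (l • a + b) := (IsSelfAdjoint.smul (.all l) has).add hbs
  refine ⟨⟨z, hz⟩, fun l hl => ?_, ?_⟩
  -- The minorant is `min l 1 • T`: use `min l 1 ≤ l` on `a`, and `min l 1 ≤ 1` on `b` and `1 - q`.
  -- The resulting bound depends on `l`, but only existence matters here.
  · have hc : 0 < min l 1 := by positivity
    obtain ⟨_, hK⟩ :=
      exists_norm_le_of_isStrictlyPositive_le (IsStrictlyPositive.smul hc hT) hq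
    obtain ⟨w, hw, -⟩ := hK _ (hmq l) (hms l) (by
      rw [smul_add, smul_add]
      gcongr
      · exact min_le_left _ _
      · exact (smul_le_smul_of_nonneg_right (min_le_right l 1) hb).trans_eq (one_smul _ _)
      · exact (smul_le_smul_of_nonneg_right (min_le_right l 1) hq.one_sub.nonneg).trans_eq
          (one_smul _ _))
    exact ⟨w, hw⟩
  · rw [IsMoorePenroseInverse.mpInverse_eq hz]
    refine Tendsto.mul_const b ?_
    obtain ⟨K, hK⟩ := exists_norm_le_of_isStrictlyPositive_le hT hq
    rw [tendsto_iff_norm_sub_tendsto_zero]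
    have hlim : Tendsto (fun l : ℝ => l⁻¹ * ((‖q‖ + K * ‖b‖) * ‖x * (1 - b * z)‖)) atTop (𝓝 0) := by
      simpa using tendsto_inv_atTop_zero.mul_const ((‖q‖ + K * ‖b‖) * ‖x * (1 - b * z)‖)
    refine squeeze_zero' (.of_forall fun _ => norm_nonneg _) ?_ hlim
    -- From `l = 1` on, `T` itself is a minorant, so one `K` serves all `l`.
    filter_upwards [eventually_ge_atTop 1] with l hl
    have hl0 : 0 < l := one_pos.trans_le hl
    obtain ⟨w, hw, hw1, hw2, hwK⟩ := hK _ (hmq l) (hms l) (by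
      gcongr
      exact (one_smul ℝ a).symm.trans_le (smul_le_smul_of_nonneg_right hl ha))
    rw [IsMoorePenroseInverse.mpInverse_eq hw]
    -- Solving `w (l • a + b) = q` for `w a` produces the decaying factor `l⁻¹`.
    have hwa : w * a = l⁻¹ • (q - w * b) := by
      rw [eq_inv_smul_iff₀ hl0.ne', eq_sub_iff_add_eq, ← hw2, mul_add, mul_smul_comm]
    have hwq : w * q = w := by rw [← hw1, ← mul_assoc, hw.self_mul_mul]
    have haz : a * z = 0 := by rw [← hzf, ← mul_assoc, haf, zero_mul]
    have hfbz : f * (b * z) = f := by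
      rwa [mul_assoc (f * b), hzf, mul_assoc] at hz1
    -- Split `b z` along `q = p + f`; its `f`-component is `f` because `z` inverts `f b f` in that
    -- corner.
    have hbz : b * z = p * (b * z) + f := by
      rw [hf_def, sub_mul, ← mul_assoc q, hqb] at hfbz
      rw [hf_def, ← hfbz]
      abel
    have hqz : q * z = z := by rw [← hzf, ← mul_assoc, hqf]
    -- A resolvent-type identity: since `a z = 0`, the difference is `w (q - b z)`, and `q - b z`
    -- lies in the range of `p = a x`, which exposes `w a`.
    have key : w - z = l⁻¹ • ((q - w * b) * (x * (1 - b * z))) := by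
      calc w - z = w * q - w * ((l • a + b) * z) := by rw [← mul_assoc, hw2, hwq, hqz]
        _ = w * (q - b * z) := by rw [add_mul, smul_mul_assoc, haz, smul_zero, zero_add, mul_sub]
        _ = w * (p * (1 - b * z)) := by
          nth_rewrite 1 [hbz]
          rw [mul_sub p, mul_one, hf_def]
          congr 1
          abel
        _ = w * a * (x * (1 - b * z)) := by rw [← hpx]; simp only [mul_assoc]
        _ = _ := by rw [hwa, smul_mul_assoc]
    rw [key, norm_smul, norm_inv, Real.norm_of_nonneg hl0.le]
    gcongr
    refine (norm_mul_le _ _).trans ?_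
    gcongr
    refine (norm_sub_le _ _).trans ?_
    gcongr
    exact (norm_mul_le _ _).trans (by gcongr)

end MoorePenroseCStar

theorem mainTheorem9 {𝔄 H : Type*} [NonUnitalCStarAlgebra 𝔄] [PartialOrder 𝔄] [StarOrderedRing 𝔄]
    [NormedAddCommGroup H] [NormedSpace ℂ H] [SMul 𝔄 H] [CStarModule 𝔄 H] [CompleteSpace H]
    (A B : AdjointableOperator 𝔄 H) (hA : 0 ≤ A) (hB : 0 ≤ B)
    (hA_mp : IsMPInvertible A) (hAB_mp : IsMPInvertible (A + B)) :
    IsMPInvertible ((1 - mpInverse A * A) * B * (1 - mpInverse A * A)) ∧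
    (∀ l : ℝ, 0 < l → IsMPInvertible (l • A + B)) ∧
    Tendsto (fun l : ℝ => mpInverse (l • A + B) * B) atTop
      (𝓝 (mpInverse ((1 - mpInverse A * A) * B * (1 - mpInverse A * A)) * B)) :=
  tendsto_mpInverse_smul_add_mul hA hB hA_mp hAB_mp
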